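/- Here a ring is an associative ring that need not have a unit, and homomorphisms preserve addition and multiplication. Let $\mathcal{C}$ be either the category of all rings or the category of all commutative rings. Let $\mathcal{X}$ be a subvariety of $\mathcal{C}$, that is, the full subcategory of those objects of $\mathcal{C}$ that satisfy every identity in some set $\Phi$ of identities $s=t$ between terms in the operations $0,-,+,\cdot$. Suppose that the reflection of $\mathcal{C}$ onto $\mathcal{X}$ is a localization, that is, the left adjoint $F:\mathcal{C}\to\mathcal{X}$ of the inclusion functor $\mathcal{X}\to\mathcal{C}$ preserves all finite limits. Then the reflection is trivial: either $\mathcal{X}=\mathcal{C}$, or $\mathcal{X}$ consists precisely of the zero rings. -/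

import Mathlib

universe u

open CategoryTheory CategoryTheory.Limits

/-- The category of associative rings that need not have a unit. -/
structure RngCat where
  of ::
  /-- The underlying type. -/
  carrier : Type u
  [nonUnitalRing : NonUnitalRing carrier]

attribute [instance] RngCat.nonUnitalRing

namespace RngCat

instance : CoeSort RngCat.{u} (Type u) := ⟨RngCat.carrier⟩

/-- Morphisms are all maps preserving addition and multiplication. -/
@[ext]
structure Hom (A B : RngCat.{u}) where
  /-- The underlying homomorphism. -/
  hom' : A →ₙ+* B

instance : Category RngCat.{u} where
  Hom A B := Hom A B
  id A := ⟨NonUnitalRingHom.id A⟩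
  comp f g := ⟨g.hom'.comp f.hom'⟩

instance : ConcreteCategory.{u} RngCat.{u} (fun A B => A →ₙ+* B) where
  hom := Hom.hom'
  ofHom f := ⟨f⟩

end RngCat

/-- The category of commutative associative rings that need not have a unit. -/
structure CommRngCat where
  of ::
  /-- The underlying type. -/
  carrier : Type u
  [nonUnitalCommRing : NonUnitalCommRing carrier]

attribute [instance] CommRngCat.nonUnitalCommRing

namespace CommRngCat

instance : CoeSort CommRngCat.{u} (Type u) := ⟨CommRngCat.carrier⟩

/-- Morphisms are all maps preserving addition and multiplication. -/
@[ext]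
structure Hom (A B : CommRngCat.{u}) where
  /-- The underlying homomorphism. -/
  hom' : A →ₙ+* B

instance : Category CommRngCat.{u} where
  Hom A B := Hom A B
  id A := ⟨NonUnitalRingHom.id A⟩
  comp f g := ⟨g.hom'.comp f.hom'⟩

instance : ConcreteCategory.{u} CommRngCat.{u} (fun A B => A →ₙ+* B) where
  hom := Hom.hom'
  ofHom f := ⟨f⟩

end CommRngCat

/-- Terms in the operations `0, -, +, *` of non-unital rings, with variables indexed by `ℕ`. -/
inductive RngTerm : Type
  | var (n : ℕ) : RngTerm
  | zero : RngTerm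
  | neg (s : RngTerm) : RngTerm
  | add (s t : RngTerm) : RngTerm
  | mul (s t : RngTerm) : RngTerm

namespace RngTerm

/-- The value of a term in a ring under an assignment of the variables. -/
def eval {A : Type u} [NonUnitalRing A] (v : ℕ → A) : RngTerm → A
  | var n => v n
  | zero => 0
  | neg s => -(eval v s)
  | add s t => eval v s + eval v t
  | mul s t => eval v s * eval v t

end RngTerm

/-- The ring `A` satisfies every identity `s = t` with `(s, t) ∈ Φ`. -/
def SatisfiesIdentities (A : Type u) [NonUnitalRing A] (Φ : Set (RngTerm × RngTerm)) : Prop :=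
  ∀ p ∈ Φ, ∀ v : ℕ → A, p.1.eval v = p.2.eval v

/-- The subvariety of the variety of rings determined by the identities `Φ`. -/
def RngCat.subvariety (Φ : Set (RngTerm × RngTerm)) : ObjectProperty RngCat.{u} :=
  fun A => SatisfiesIdentities A Φ

/-- The subvariety of the variety of commutative rings determined by the identities `Φ`. -/
def CommRngCat.subvariety (Φ : Set (RngTerm × RngTerm)) : ObjectProperty CommRngCat.{u} :=
  fun A => SatisfiesIdentities A Φ

/-!
The unit `η` of the reflection is natural, so `η_B ≫ GF f = f ≫ η_R` for every `f : B ⟶ R`. If `F`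
preserves monomorphisms and `f` is one, then so is `GF f`; hence whatever `f ≫ η_R` collapses is
already collapsed by `η_B`, and therefore by every morphism from `B` to a reflected object.

Suppose some ring violates an identity `s = t` of the subvariety. Let `R` be the free algebra over
`ℤ` on the variables and let `r ≠ 0` be the value of `s - t` at the generators. As `R` has no zero
divisors and `r` lies in the augmentation ideal, `r` is transcendental over `ℤ`, so that it
generates a copy `B` of the free nonunital ring on one generator. Since `η_R r = 0`, all
homomorphisms from `B` to rings of the subvariety vanish, that is, all these rings are zero.
-/

open Polynomial

theorem transcendental_of_augmentation_eq_zero {k R : Type*} [CommRing k] [Ring R] [Algebra k R]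
    [NoZeroDivisors R] (ε : R →ₐ[k] k) {r : R} (hr : r ≠ 0) (hε : ε r = 0) :
    Transcendental k r := by
  refine transcendental_iff.2 fun q hq => by_contra fun hq₀ => ?_
  obtain ⟨m, q, rfl, hX⟩ : ∃ m q', q = X ^ m * q' ∧ ¬X ∣ q' :=
    ⟨_, by simpa using exists_eq_pow_rootMultiplicity_mul_and_not_dvd q hq₀ 0⟩
  have hεq : ε (aeval r q) = q.coeff 0 := by
    rw [← aeval_algHom_apply, hε, coeff_zero_eq_aeval_zero]
  have hqr : aeval r q ≠ 0 := fun h => hX <| by rw [X_dvd_iff, ← hεq, h, map_zero]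
  have : Nontrivial R := ⟨r, 0, hr⟩
  rw [map_mul, map_pow, aeval_X] at hq
  exact mul_ne_zero (pow_ne_zero m hr) hqr hq

theorem fst_aeval_inr {k A : Type*} [CommRing k] [NonUnitalRing A] [Module k A]
    [IsScalarTower k A A] [SMulCommClass k A A] (a : A) (q : k[X]) :
    (aeval (Unitization.inr a : Unitization k A) q).fst = q.coeff 0 := by
  change Unitization.fstHom k A (aeval (Unitization.inr a : Unitization k A) q) = q.coeff 0
  rw [← aeval_algHom_apply, coeff_zero_eq_aeval_zero]
  rfl

/-- The free nonunital ring on one generator `X`, realized as the integer polynomials without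
constant term. -/
def freeMonogenicRng : NonUnitalSubring ℤ[X] where
  carrier := {q | q.coeff 0 = 0}
  zero_mem' := coeff_zero 0
  add_mem' {p q} (hp : p.coeff 0 = 0) (hq : q.coeff 0 = 0) := by simp [hp, hq]
  neg_mem' {q} (hq : q.coeff 0 = 0) := by simp [hq]
  mul_mem' {p q} (hp : p.coeff 0 = 0) _ := by simp [mul_coeff_zero, hp]

namespace freeMonogenicRng

/-- The generator of the free nonunital ring on one generator. -/
noncomputable def generator : freeMonogenicRng := ⟨X, coeff_X_zero⟩

section

variable {A : Type*} [NonUnitalRing A]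

/-- The homomorphism sending the generator to `a`. A polynomial is evaluated at `a` in the
unitization of `A`, where the value of one without constant term lies in `A`. -/
noncomputable def lift (a : A) : freeMonogenicRng →ₙ+* A where
  toFun q := (aeval (Unitization.inr a : Unitization ℤ A) q.1).snd
  map_zero' := by simp
  map_add' p q := by simp
  map_mul' p q := by
    have hp : p.1.coeff 0 = 0 := p.2
    have hq : q.1.coeff 0 = 0 := q.2
    simp [fst_aeval_inr, hp, hq]

theorem lift_generator (a : A) : lift a generator = a := by
  change (aeval (Unitization.inr a : Unitization ℤ A) X).snd = a
  rw [aeval_X, Unitization.snd_inr]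

theorem eq_zero_of_map_generator_eq_zero (g : freeMonogenicRng →ₙ+* A) (hg : g generator = 0) :
    g = 0 := by
  ext q
  obtain ⟨p, hp⟩ := X_dvd_iff.2 q.2
  have hp₀ : p - C (p.coeff 0) ∈ freeMonogenicRng := by
    change (p - C (p.coeff 0)).coeff 0 = 0
    simp
  have hq : q = p.coeff 0 • generator + generator * ⟨_, hp₀⟩ := Subtype.ext <| by
    change q.1 = p.coeff 0 • X + X * (p - C (p.coeff 0))
    rw [hp, ← C_mul']
    ring
  rw [hq, map_add, map_zsmul, map_mul, hg, smul_zero, zero_mul, add_zero,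
    NonUnitalRingHom.zero_apply]

end

theorem lift_eq_aeval {R : Type*} [Ring R] (r : R) (q : freeMonogenicRng) :
    lift r q = aeval r q.1 := by
  have hq : q.1.coeff 0 = 0 := q.2
  let π : Unitization ℤ R →ₐ[ℤ] R := Unitization.lift (NonUnitalAlgHom.id ℤ R)
  have hπ (z : Unitization ℤ R) : π z = algebraMap ℤ R z.fst + z.snd := rfl
  calc lift r q = π (aeval (Unitization.inr r) q.1) := by
        rw [hπ, fst_aeval_inr, hq, map_zero, zero_add]
        rfl
    _ = aeval (π (Unitization.inr r)) q.1 := (aeval_algHom_apply π _ _).symm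
    _ = aeval r q.1 := by rw [hπ, Unitization.fst_inr, Unitization.snd_inr, map_zero, zero_add]

theorem lift_injective_of_transcendental {R : Type*} [Ring R] {r : R} (hr : Transcendental ℤ r) :
    Function.Injective (lift r) := by
  intro p q h
  rw [lift_eq_aeval, lift_eq_aeval] at h
  exact Subtype.ext (transcendental_iff_injective.1 hr h)

end freeMonogenicRng

namespace RngTerm

theorem map_eval {A B : Type*} [NonUnitalRing A] [NonUnitalRing B] (g : A →ₙ+* B) (v : ℕ → A)
    (s : RngTerm) : g (s.eval v) = s.eval fun n => g (v n) := by
  induction s <;> simp_all [eval]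

theorem transcendental_eval_sub_eval {A R : Type*} [NonUnitalRing A] [Ring R] [NoZeroDivisors R]
    (g : R →ₐ[ℤ] Unitization ℤ A) {x : ℕ → R} {v : ℕ → A}
    (hg : ∀ n, g (x n) = Unitization.inr (v n)) {s t : RngTerm} (hst : s.eval v ≠ t.eval v) :
    Transcendental ℤ (s.eval x - t.eval x) := by
  have hg_eval (s : RngTerm) : g (s.eval x) = Unitization.inr (s.eval v) := by
    calc g (s.eval x) = s.eval fun n => g (x n) :=
          map_eval (B := Unitization ℤ A) (g : R →ₙ+* Unitization ℤ A) x s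
      _ = s.eval fun n => Unitization.inr (v n) := by simp only [hg]
      _ = Unitization.inr (s.eval v) :=
          (map_eval (B := Unitization ℤ A) (Unitization.inrNonUnitalAlgHom ℤ A) v s).symm
  have hg_sub : g (s.eval x - t.eval x) = Unitization.inr (s.eval v - t.eval v) := by
    rw [map_sub, hg_eval, hg_eval, Unitization.inr_sub]
  refine transcendental_of_augmentation_eq_zero ((Unitization.fstHom ℤ A).comp g) (fun h => ?_) ?_
  · rw [h, map_zero, ← Unitization.inr_zero ℤ] at hg_sub
    exact hst (sub_eq_zero.1 (Unitization.inr_injective hg_sub.symm))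
  · rw [AlgHom.comp_apply, hg_sub]
    rfl

end RngTerm

theorem comp_eq_comp_of_comp_unit_eq {C D : Type*} [Category* C] [Category* D] {F : C ⥤ D}
    {G : D ⥤ C} (adj : F ⊣ G) [F.PreservesMonomorphisms] {T B R : C} (f : B ⟶ R) [Mono f]
    {u v : T ⟶ B} (h : u ≫ f ≫ adj.unit.app R = v ≫ f ≫ adj.unit.app R) {Y : D}
    (g : B ⟶ G.obj Y) : u ≫ g = v ≫ g := by
  have := adj.isRightAdjoint
  have hunit : u ≫ adj.unit.app B = v ≫ adj.unit.app B := by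
    rw [← cancel_mono (G.map (F.map f))]
    simpa using h
  rw [← (adj.homEquiv B Y).apply_symm_apply g, adj.homEquiv_unit, reassoc_of% hunit]

section RingCategories

-- `C` is a category of nonunital rings in which all ring homomorphisms are morphisms.
variable {C D : Type*} [Category* C] [Category* D] {CC : C → Type*} [∀ A, NonUnitalRing (CC A)]
  [ConcreteCategory C fun A B => CC A →ₙ+* CC B] {F : C ⥤ D} {G : D ⥤ C} (adj : F ⊣ G)
  [F.PreservesMonomorphisms]

include adj

theorem ringHom_eq_zero_of_unit_apply_eq_zero {B R : C} {f : CC B →ₙ+* CC R}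
    (hf : Function.Injective f) (hunit : ∀ b, adj.unit.app R (f b) = 0) {Y : D}
    (g : CC B →ₙ+* CC (G.obj Y)) : g = 0 := by
  have : Mono (ConcreteCategory.ofHom f : B ⟶ R) :=
    ConcreteCategory.mono_of_injective _ (by simpa using hf)
  have hcomp : (ConcreteCategory.ofHom 0 : B ⟶ B) ≫ ConcreteCategory.ofHom f ≫ adj.unit.app R =
      𝟙 B ≫ ConcreteCategory.ofHom f ≫ adj.unit.app R := by
    ext b
    simp [hunit b]
  have h := comp_eq_comp_of_comp_unit_eq adj _ hcomp (ConcreteCategory.ofHom g)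
  ext b
  simpa using (ConcreteCategory.congr_hom h b).symm

theorem subsingleton_of_unit_apply_eq_zero {B R : C} (e : CC B ≃+* freeMonogenicRng) {r : CC R}
    (hr : Function.Injective (freeMonogenicRng.lift r)) (hunit : adj.unit.app R r = 0) (Y : D) :
    Subsingleton (CC (G.obj Y)) := by
  let η : CC R →ₙ+* CC (G.obj (F.obj R)) := ConcreteCategory.hom (adj.unit.app R)
  have hη : η.comp (freeMonogenicRng.lift r) = 0 :=
    freeMonogenicRng.eq_zero_of_map_generator_eq_zero _ <|
      (congrArg η (freeMonogenicRng.lift_generator r)).trans hunit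
  refine subsingleton_of_forall_eq 0 fun a => ?_
  have ha : (freeMonogenicRng.lift a).comp e.toNonUnitalRingHom = 0 :=
    ringHom_eq_zero_of_unit_apply_eq_zero adj
      (f := (freeMonogenicRng.lift r).comp e.toNonUnitalRingHom) (hr.comp e.injective)
      (fun b => DFunLike.congr_fun hη (e b)) _
  simpa [freeMonogenicRng.lift_generator] using
    DFunLike.congr_fun ha (e.symm freeMonogenicRng.generator)

theorem satisfiesIdentities_or_subsingleton_of_injective_lift {Φ : Set (RngTerm × RngTerm)}
    (hΦ : ∀ Y : D, SatisfiesIdentities (CC (G.obj Y)) Φ) {B R : C} (e : CC B ≃+* freeMonogenicRng)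
    (x : ℕ → CC R) (hx : ∀ (A : C) (v : ℕ → CC A) (s t : RngTerm), s.eval v ≠ t.eval v →
      Function.Injective (freeMonogenicRng.lift (s.eval x - t.eval x))) :
    (∀ A : C, SatisfiesIdentities (CC A) Φ) ∨ ∀ Y : D, Subsingleton (CC (G.obj Y)) := by
  refine or_iff_not_imp_left.2 fun hC => ?_
  simp only [SatisfiesIdentities, not_forall] at hC
  obtain ⟨A, ⟨s, t⟩, hst, v, hv⟩ := hC
  refine subsingleton_of_unit_apply_eq_zero adj e (hx A v s t hv) ?_
  rw [map_sub, RngTerm.map_eval, RngTerm.map_eval, sub_eq_zero]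
  exact hΦ (F.obj R) (s, t) hst _

end RingCategories

theorem RngCat.satisfiesIdentities_or_subsingleton {D : Type*} [Category* D] {F : RngCat.{u} ⥤ D}
    {G : D ⥤ RngCat.{u}} (adj : F ⊣ G) [F.PreservesMonomorphisms] {Φ : Set (RngTerm × RngTerm)}
    (hΦ : ∀ Y, SatisfiesIdentities (G.obj Y) Φ) :
    (∀ A : RngCat.{u}, SatisfiesIdentities A Φ) ∨ ∀ Y, Subsingleton (G.obj Y) :=
  satisfiesIdentities_or_subsingleton_of_injective_lift adj hΦ
    (B := .of (ULift freeMonogenicRng)) (R := .of (FreeAlgebra ℤ (ULift ℕ)))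
    ULift.ringEquiv (fun n => FreeAlgebra.ι ℤ ⟨n⟩)
    fun A v _ _ hst => freeMonogenicRng.lift_injective_of_transcendental <|
      RngTerm.transcendental_eval_sub_eval
        (FreeAlgebra.lift ℤ fun n : ULift ℕ => (Unitization.inr (v n.down) : Unitization ℤ A))
        (fun _ => FreeAlgebra.lift_ι_apply _ _) hst

theorem CommRngCat.satisfiesIdentities_or_subsingleton {D : Type*} [Category* D]
    {F : CommRngCat.{u} ⥤ D} {G : D ⥤ CommRngCat.{u}} (adj : F ⊣ G) [F.PreservesMonomorphisms]
    {Φ : Set (RngTerm × RngTerm)} (hΦ : ∀ Y, SatisfiesIdentities (G.obj Y) Φ) :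
    (∀ A : CommRngCat.{u}, SatisfiesIdentities A Φ) ∨ ∀ Y, Subsingleton (G.obj Y) :=
  satisfiesIdentities_or_subsingleton_of_injective_lift adj hΦ
    (B := .of (ULift freeMonogenicRng)) (R := .of (MvPolynomial (ULift ℕ) ℤ))
    ULift.ringEquiv (fun n => MvPolynomial.X ⟨n⟩)
    fun A v _ _ hst => freeMonogenicRng.lift_injective_of_transcendental <|
      RngTerm.transcendental_eval_sub_eval
        (MvPolynomial.aeval fun n : ULift ℕ => (Unitization.inr (v n.down) : Unitization ℤ A))
        (fun _ => MvPolynomial.aeval_X _ _) hst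

theorem SatisfiesIdentities.of_subsingleton (A : Type*) [NonUnitalRing A] [Subsingleton A]
    (Φ : Set (RngTerm × RngTerm)) : SatisfiesIdentities A Φ :=
  fun _ _ _ => Subsingleton.elim _ _

theorem mainTheorem9_general :
    (∀ (Φ : Set (RngTerm × RngTerm))
        (F : RngCat.{u} ⥤ (RngCat.subvariety.{u} Φ).FullSubcategory)
        (_ : F ⊣ (RngCat.subvariety.{u} Φ).ι) (_ : F.PreservesMonomorphisms),
      (∀ A : RngCat.{u}, RngCat.subvariety Φ A) ∨
        (∀ A : RngCat.{u}, RngCat.subvariety Φ A ↔ Subsingleton A)) ∧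
    (∀ (Φ : Set (RngTerm × RngTerm))
        (F : CommRngCat.{u} ⥤ (CommRngCat.subvariety.{u} Φ).FullSubcategory)
        (_ : F ⊣ (CommRngCat.subvariety.{u} Φ).ι) (_ : F.PreservesMonomorphisms),
      (∀ A : CommRngCat.{u}, CommRngCat.subvariety Φ A) ∨
        (∀ A : CommRngCat.{u}, CommRngCat.subvariety Φ A ↔ Subsingleton A)) := by
  refine ⟨fun Φ F adj _ => ?_, fun Φ F adj _ => ?_⟩
  · refine (RngCat.satisfiesIdentities_or_subsingleton adj fun Y => Y.property).imp_right ?_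
    exact fun h A => ⟨fun hA => h ⟨A, hA⟩, fun _ => .of_subsingleton A Φ⟩
  · refine (CommRngCat.satisfiesIdentities_or_subsingleton adj fun Y => Y.property).imp_right ?_
    exact fun h A => ⟨fun hA => h ⟨A, hA⟩, fun _ => .of_subsingleton A Φ⟩

theorem mainTheorem9 :
    (∀ (Φ : Set (RngTerm × RngTerm))
        (F : RngCat.{u} ⥤ (RngCat.subvariety.{u} Φ).FullSubcategory)
        (_ : F ⊣ (RngCat.subvariety.{u} Φ).ι) (_ : PreservesFiniteLimits F),
      (∀ A : RngCat.{u}, RngCat.subvariety Φ A) ∨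
        (∀ A : RngCat.{u}, RngCat.subvariety Φ A ↔ Subsingleton A)) ∧
    (∀ (Φ : Set (RngTerm × RngTerm))
        (F : CommRngCat.{u} ⥤ (CommRngCat.subvariety.{u} Φ).FullSubcategory)
        (_ : F ⊣ (CommRngCat.subvariety.{u} Φ).ι) (_ : PreservesFiniteLimits F),
      (∀ A : CommRngCat.{u}, CommRngCat.subvariety Φ A) ∨
        (∀ A : CommRngCat.{u}, CommRngCat.subvariety Φ A ↔ Subsingleton A)) :=
  ⟨fun Φ F adj _ => mainTheorem9_general.1 Φ F adj inferInstance,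
    fun Φ F adj _ => mainTheorem9_general.2 Φ F adj inferInstance⟩
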